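/- Let $X$ be a complete metric space that is neither discrete (as a topological space) nor compact, and let $G$ be a topological group containing an arc, i.e. a subspace homeomorphic to the unit interval $[0,1]$. Let $\mathrm{C}(X,G)$ be the set of continuous functions $X\to G$ with the compact-open topology. Notation. For a topological space $Y$, let $w(Y)$ be its weight (the minimal cardinality of a basis of $Y$) and $d(Y)$ its density (the minimal cardinality of a dense subset of $Y$). For a point $x\in X$, let $\mathrm{ld}(x)$ be the minimal density of a neighborhood of $x$. The cofinality $\mathrm{cof}(P)$ of a partially ordered set $P$ is the minimal cardinality of a subset $C\subseteq P$ such that for each $p\in P$ there is $c\in C$ with $p\le c$. For a cardinal number $\kappa$, let $[\kappa]^{\aleph_0}$ be the family of countably infinite subsets of $\kappa$, ordered by inclusion (for finite $\kappa$ this family is empty and has cofinality $0$). Let $\mathfrak d=\mathrm{cof}(\mathbb N^{\mathbb N},\le)$, where $\le$ is the pointwise order. 1. If $X$ is locally compact, then $$d(X)\le w(\mathrm{C}(X,G))\le w(G)\cdot d(X).$$ 2. If $X$ is not locally compact, then $$d(X)\cdot\mathfrak d\cdot\sup_{x\in X}\mathrm{cof}\bigl([\mathrm{ld}(x)]^{\aleph_0}\bigr)\le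 w(\mathrm{C}(X,G))\le w(G)\cdot d(X)\cdot\mathfrak d\cdot\sup_{x\in X}\mathrm{cof}\bigl([\mathrm{ld}(x)]^{\aleph_0}\bigr).$$ -/

import Mathlib

open Cardinal Topology

universe u v

/-- The weight of a topological space: the minimal cardinality of a basis. -/
noncomputable def topWeight (X : Type u) [TopologicalSpace X] : Cardinal.{u} :=
  sInf {c | ∃ B : Set (Set X), TopologicalSpace.IsTopologicalBasis B ∧ #B = c}

/-- The density of a topological space: the minimal cardinality of a dense subset. -/
noncomputable def topDensity (X : Type u) [TopologicalSpace X] : Cardinal.{u} :=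
  sInf {c | ∃ D : Set X, Dense D ∧ #D = c}

/-- The local density of a point: the minimal density (as a subspace) of a neighborhood of it. -/
noncomputable def localDensity {X : Type u} [TopologicalSpace X] (x : X) : Cardinal.{u} :=
  sInf {c | ∃ U : Set X, U ∈ 𝓝 x ∧ topDensity U = c}

/-- The family of countably infinite subsets of (a set of cardinality) `κ`, ordered by
inclusion. -/
abbrev CountablyInfiniteSubsets (κ : Cardinal.{u}) : Type u :=
  {s : Set κ.out // #s = ℵ₀}

/-- The dominating number: the cofinality of the functions `ℕ → ℕ`, ordered pointwise. -/
noncomputable def dominatingNumber : Cardinal.{0} :=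
  Order.cof (ℕ → ℕ)

/-- The topological space `Y` contains an arc, that is, a subspace homeomorphic to the
unit interval. -/
def ContainsArc (Y : Type u) [TopologicalSpace Y] : Prop :=
  ∃ A : Set Y, Nonempty (A ≃ₜ unitInterval)

open Set Filter TopologicalSpace Metric

/-! ### Attained minima for weight, density and local density -/

section CardinalInvariants

/-! Everything reduces to the cofinality `cof` of the compact subsets of `X` under inclusion: `cof ≤
w(C(X,G)) ≤ w(G) · cof`. Maps running along an arc of `G` turn a neighborhood base at a constant map
into a cofinal family of compacts; conversely, a cofinal family and a basis of `G` give a small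
subbasis of the compact-open topology.

It remains to compute `cof`. A compact set inside a neighborhood of density `ld(x)` is controlled by
a countable set of centers and a function `ℕ → ℕ` bounding finite nets at each scale; finite unions
globalize this at the cost of a factor `d(X)`. For the lower bounds, convergent sequences encode
countable sets and functions as compacts (Tukey maps), and some dense set meets every compact in a
countable set. Noncompactness makes `cof` and `d(X)` infinite, so that products are absorbed. -/

theorem exists_isTopologicalBasis_mk_eq (X : Type u) [TopologicalSpace X] :
    ∃ B : Set (Set X), IsTopologicalBasis B ∧ #B = topWeight X :=
  csInf_mem (s := {c | ∃ B : Set (Set X), IsTopologicalBasis B ∧ #B = c})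
    ⟨_, _, isTopologicalBasis_opens, rfl⟩

theorem topWeight_le {X : Type u} [TopologicalSpace X] {B : Set (Set X)}
    (hB : IsTopologicalBasis B) : topWeight X ≤ #B :=
  csInf_le' ⟨B, hB, rfl⟩

theorem exists_dense_mk_eq (X : Type u) [TopologicalSpace X] :
    ∃ D : Set X, Dense D ∧ #D = topDensity X :=
  csInf_mem (s := {c | ∃ D : Set X, Dense D ∧ #D = c}) ⟨_, univ, dense_univ, rfl⟩

theorem topDensity_le {X : Type u} [TopologicalSpace X] {D : Set X} (hD : Dense D) :
    topDensity X ≤ #D :=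
  csInf_le' ⟨D, hD, rfl⟩

theorem exists_nhds_subset_closure_mk_eq {X : Type u} [TopologicalSpace X] (x : X) :
    ∃ U ∈ 𝓝 x, ∃ D : Set X, U ⊆ closure D ∧ #D = localDensity x := by
  obtain ⟨U, hU, hUx⟩ :=
    csInf_mem (s := {c | ∃ U : Set X, U ∈ 𝓝 x ∧ topDensity U = c}) ⟨_, univ, univ_mem, rfl⟩
  obtain ⟨D, hD, hDU⟩ := exists_dense_mk_eq U
  refine ⟨U, hU, (↑) '' D, Subtype.dense_iff.1 hD, ?_⟩
  rw [mk_image_eq Subtype.val_injective, hDU, hUx, localDensity]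

theorem localDensity_le {X : Type u} [TopologicalSpace X] {x : X} {U D : Set X} (hU : U ∈ 𝓝 x)
    (hDU : D ⊆ U) (hD : U ⊆ closure D) : localDensity x ≤ #D := by
  refine (csInf_le' (show topDensity U ∈ {c | ∃ U : Set X, U ∈ 𝓝 x ∧ topDensity U = c} from
    ⟨U, hU, rfl⟩)).trans ?_
  have hd : Dense ((↑) ⁻¹' D : Set U) := by
    rw [Subtype.dense_iff, Subtype.image_preimage_coe, inter_eq_right.2 hDU]
    exact hD
  exact (topDensity_le hd).trans (mk_preimage_of_injective _ _ Subtype.val_injective)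

/-- A Tukey morphism bounds cofinalities. -/
theorem lift_cof_le_of_tukey {α : Type u} {β : Type v} [Preorder α] [Preorder β]
    (ψ : α → β) (h : ∀ b, ∃ a', ∀ a, ψ a ≤ b → a ≤ a') :
    lift.{v} (Order.cof α) ≤ lift.{u} (Order.cof β) := by
  choose φ hφ using h
  rw [Order.le_lift_cof_iff]
  intro s hs
  have : IsCofinal (φ '' s) := fun a ↦ by
    obtain ⟨b, hb, hab⟩ := hs (ψ a)
    exact ⟨φ b, mem_image_of_mem _ hb, hφ b a hab⟩
  exact (lift_le.2 (Order.cof_le this)).trans mk_image_le_lift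

theorem aleph0_le_topDensity (X : Type u) [TopologicalSpace X] [T1Space X] [NoncompactSpace X] :
    ℵ₀ ≤ topDensity X := by
  obtain ⟨D, hD, hDX⟩ := exists_dense_mk_eq X
  rw [← hDX]
  by_contra! h
  have hf : D.Finite := lt_aleph0_iff_set_finite.1 h
  have : D = Set.univ := by rw [← hf.isClosed.closure_eq, hD.closure_eq]
  exact noncompact_univ X (this ▸ hf.isCompact)

end CardinalInvariants

/-! ### Upper bounds for the cofinality of the compact sets -/

section UpperBound

theorem exists_mk_le_forall_exists_mem {X : Type u} [PseudoMetricSpace X] {U : X → Set X}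
    (hU : ∀ x, U x ∈ 𝓝 x) :
    ∃ T : Set X, #T ≤ topDensity X * ℵ₀ ∧ ∀ y, ∃ x ∈ T, y ∈ interior (U x) := by
  obtain ⟨D, hD, hDX⟩ := exists_dense_mk_eq X
  -- One `x` per ball with center in `D` and radius `1/(n+1)` suffices; balls inside no `U z` get a
  -- dummy value.
  have key : ∀ p : D × ℕ, ∃ x : X, (∃ z, ball (p.1 : X) (1 / (p.2 + 1)) ⊆ U z) →
      ball (p.1 : X) (1 / (p.2 + 1)) ⊆ U x := fun p ↦ by
    by_cases h : ∃ z, ball (p.1 : X) (1 / (p.2 + 1)) ⊆ U z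
    · exact ⟨h.choose, fun _ ↦ h.choose_spec⟩
    · exact ⟨p.1, fun h' ↦ absurd h' h⟩
  choose t ht using key
  refine ⟨range t, ?_, fun y ↦ ?_⟩
  · refine mk_range_le.trans ?_
    simp [hDX]
  · obtain ⟨ε, hε, hεU⟩ := Metric.mem_nhds_iff.1 (hU y)
    obtain ⟨n, hn⟩ := exists_nat_one_div_lt (half_pos hε)
    obtain ⟨d, hdD, hd⟩ := hD.exists_dist_lt y (Nat.one_div_pos_of_nat (n := n) (α := ℝ))
    refine ⟨t (⟨d, hdD⟩, n), mem_range_self _, mem_interior.2 ⟨ball d (1 / (n + 1)),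
      ht (⟨d, hdD⟩, n) ⟨y, fun z hz ↦ hεU ?_⟩, isOpen_ball, hd⟩⟩
    rw [mem_ball] at hz ⊢
    have := dist_triangle z d y
    rw [dist_comm d y] at this
    dsimp only at hz
    linarith

/-- A compact set splits into finitely many compact pieces, each inside some `U x` with `x` in a
small set `T`. Finite joins of members of the local families are therefore cofinal. -/
theorem cof_compacts_le_of_locally {X : Type u} [MetricSpace X] {c : Cardinal.{u}} (hc : ℵ₀ ≤ c)
    (hd : topDensity X ≤ c)
    (h : ∀ x : X, ∃ U ∈ 𝓝 x, ∃ F : Set (Compacts X), #F ≤ c ∧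
      ∀ K : Compacts X, (K : Set X) ⊆ U → ∃ L ∈ F, K ≤ L) :
    Order.cof (Compacts X) ≤ c := by
  classical
  choose U hU F hFc hF using h
  obtain ⟨T, hT, hTU⟩ := exists_mk_le_forall_exists_mem hU
  have hTc : #T ≤ c := hT.trans (mul_le_of_le hc hd hc)
  let A : Set (Compacts X) := ⋃ x ∈ T, F x
  have hA : #A ≤ c := by
    refine (mk_biUnion_le _ _).trans (mul_le_of_le hc hTc (ciSup_le' fun x ↦ hFc x))
  have hcof : IsCofinal (range fun l : List A ↦ (l.map (↑)).foldr (· ⊔ ·) (⊥ : Compacts X)) := by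
    intro K
    obtain ⟨t, ht⟩ := K.isCompact.elim_finite_subcover (fun x : T ↦ interior (U x))
      (fun _ ↦ isOpen_interior) fun y _ ↦ by
        obtain ⟨x, hx, hy⟩ := hTU y
        exact mem_iUnion.2 ⟨⟨x, hx⟩, hy⟩
    obtain ⟨κ, hκc, hκU, hκ⟩ := K.isCompact.finite_compact_cover t (fun x : T ↦ interior (U x))
      (fun _ _ ↦ isOpen_interior) ht
    choose L hLF hL using fun x : T ↦ hF x ⟨κ x, hκc x⟩ ((hκU x).trans interior_subset)
    refine ⟨_, mem_range_self (t.toList.map fun x ↦ ⟨L x, mem_biUnion x.2 (hLF x)⟩), ?_⟩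
    refine fun y (hy : y ∈ (K : Set X)) ↦ ?_
    rw [hκ] at hy
    obtain ⟨x, hx, hyx⟩ := mem_iUnion₂.1 hy
    have hle : ∀ l : List T, x ∈ l →
        L x ≤ ((l.map fun x ↦ (⟨L x, mem_biUnion x.2 (hLF x)⟩ : A)).map (↑)).foldr (· ⊔ ·)
          (⊥ : Compacts X) := by
      intro l
      induction l with
      | nil => simp
      | cons a l ih =>
        intro h
        rcases List.mem_cons.1 h with rfl | h
        · exact le_sup_left
        · exact (ih h).trans le_sup_right
    exact hle _ (Finset.mem_toList.2 hx) (hL x hyx)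
  exact (Order.cof_le hcof).trans (mk_range_le.trans ((mk_list_le_max A).trans (max_le hc hA)))

theorem cof_compacts_le_topDensity (X : Type u) [MetricSpace X] [NoncompactSpace X]
    [LocallyCompactSpace X] : Order.cof (Compacts X) ≤ topDensity X := by
  refine cof_compacts_le_of_locally (aleph0_le_topDensity X) le_rfl fun x ↦ ?_
  obtain ⟨K, hK, hKx⟩ := exists_compact_mem_nhds x
  exact ⟨K, hKx, {⟨K, hK⟩}, by simpa using one_le_aleph0.trans (aleph0_le_topDensity X),
    fun L hL ↦ ⟨_, rfl, hL⟩⟩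

theorem isCompact_iInter_biUnion_closedBall {X : Type u} [PseudoMetricSpace X] [CompleteSpace X]
    (s : ℕ → X) (g : ℕ → ℕ) :
    IsCompact (⋂ n : ℕ, ⋃ i ∈ Iic (g n), closedBall (s i) (1 / (n + 1))) := by
  refine TotallyBounded.isCompact_of_isClosed ?_ (isClosed_iInter fun n ↦
    (finite_Iic _).isClosed_biUnion fun i _ ↦ isClosed_closedBall)
  refine Metric.totallyBounded_iff.2 fun ε hε ↦ ?_
  obtain ⟨n, hn⟩ := exists_nat_one_div_lt hε
  refine ⟨s '' Iic (g n), (finite_Iic _).image s, (iInter_subset _ n).trans ?_⟩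
  rw [biUnion_image]
  exact iUnion₂_mono fun i _ ↦ closedBall_subset_ball hn

/-- The pair (countable set of centers, bound on the indices used at scale `1/(n+1)`) determines a
closed, totally bounded set. The `max 1` covers finite `D`, where there are no countably infinite
subsets and `D` itself serves. -/
theorem exists_compacts_family {X : Type u} [MetricSpace X] [CompleteSpace X] (x : X) :
    ∃ U ∈ 𝓝 x, ∃ F : Set (Compacts X),
      #F ≤ max 1 (Order.cof (CountablyInfiniteSubsets (localDensity x)) *
        lift.{u} dominatingNumber) ∧
      ∀ K : Compacts X, (K : Set X) ⊆ U → ∃ L ∈ F, K ≤ L := by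
  obtain ⟨U, hU, D, hUD, hD⟩ := exists_nhds_subset_closure_mk_eq x
  refine ⟨U, hU, ?_⟩
  rcases D.finite_or_infinite with hfin | hinf
  · refine ⟨{⟨D, hfin.isCompact⟩}, by simp, fun K hK ↦ ⟨_, rfl, ?_⟩⟩
    exact (hK.trans hUD).trans hfin.isClosed.closure_eq.subset
  obtain ⟨C, hC, hCc⟩ := Order.exists_cof_eq (CountablyInfiniteSubsets (localDensity x))
  obtain ⟨P, hP, hPc⟩ := Order.exists_cof_eq (ℕ → ℕ)
  obtain ⟨e⟩ : Nonempty ((localDensity x).out ≃ D) := by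
    rw [← Cardinal.eq, mk_out, hD]
  have : Infinite D := hinf.to_subtype
  have : Infinite (localDensity x).out := e.infinite_iff.2 ‹_›
  have hnum : ∀ S : CountablyInfiniteSubsets (localDensity x), Nonempty (ℕ ≃ S.1) := fun S ↦ by
    obtain ⟨hS⟩ := denumerable_iff.2 S.2
    exact ⟨(Denumerable.eqv S.1).symm⟩
  let num := fun S ↦ (hnum S).some
  let Q : C × P → Compacts X := fun p ↦
    ⟨_, isCompact_iInter_biUnion_closedBall (fun i ↦ (e (num p.1.1 i) : X)) p.2.1⟩
  refine ⟨range Q, ?_, fun K hK ↦ ?_⟩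
  · refine le_max_of_le_right ?_
    have := mk_range_le_lift (f := Q)
    simpa [hCc, dominatingNumber, ← hPc] using this
  have hfin : ∀ n : ℕ, ∃ t : Set D, t.Finite ∧
      (K : Set X) ⊆ ⋃ d ∈ t, ball (d : X) (1 / (n + 1)) := fun n ↦ by
    obtain ⟨t, ht⟩ := K.isCompact.elim_finite_subcover (fun d : D ↦ ball (d : X) (1 / (n + 1)))
      (fun _ ↦ isOpen_ball) fun y hy ↦ by
        obtain ⟨d, hd, hyd⟩ := Metric.mem_closure_iff.1 (hUD (hK hy)) (1 / (n + 1))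
          Nat.one_div_pos_of_nat
        exact mem_iUnion.2 ⟨⟨d, hd⟩, hyd⟩
    exact ⟨t, t.finite_toSet, by simpa using ht⟩
  choose t htf ht using hfin
  -- The added range makes the set of centers infinite even if the nets use only finitely many
  -- points.
  let S₀ : Set (localDensity x).out := (e ⁻¹' ⋃ n, t n) ∪ range (Infinite.natEmbedding _)
  have hS₀ : #S₀ = ℵ₀ := by
    have h1 : S₀.Countable :=
      ((countable_iUnion fun n ↦ (htf n).countable).preimage e.injective).union (countable_range _)
    have h2 : S₀.Infinite :=
      (infinite_range_of_injective (Infinite.natEmbedding _).injective).mono subset_union_right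
    have := h1.to_subtype
    have := h2.to_subtype
    exact mk_eq_aleph0 S₀
  obtain ⟨S, hSC, hS⟩ := hC ⟨S₀, hS₀⟩
  have hidx : ∀ n, ∃ m, ∀ d ∈ t n, ∃ i ≤ m, e (num S i) = d := fun n ↦ by
    have : ∀ d : D, ∃ i, d ∈ t n → e (num S i) = d := fun d ↦ by
      by_cases hd : d ∈ t n
      · have hmem : e.symm d ∈ S.1 := hS (Or.inl (by simpa using ⟨n, hd⟩))
        exact ⟨(num S).symm ⟨_, hmem⟩, fun _ ↦ by simp⟩
      · exact ⟨0, fun h ↦ absurd h hd⟩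
    choose i hi using this
    obtain ⟨m, hm⟩ := ((htf n).image i).bddAbove
    exact ⟨m, fun d hd ↦ ⟨i d, hm (mem_image_of_mem _ hd), hi d hd⟩⟩
  choose f hf using hidx
  obtain ⟨g, hgP, hg⟩ := hP f
  refine ⟨_, mem_range_self (⟨S, hSC⟩, ⟨g, hgP⟩), fun y hy ↦ ?_⟩
  refine mem_iInter.2 fun n ↦ ?_
  obtain ⟨d, hd, hyd⟩ := mem_iUnion₂.1 (ht n hy)
  obtain ⟨i, hi, hid⟩ := hf n d hd
  refine mem_iUnion₂.2 ⟨i, hi.trans (hg n), ?_⟩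
  simp only [hid]
  exact ball_subset_closedBall hyd

theorem one_le_dominatingNumber : 1 ≤ dominatingNumber :=
  Cardinal.one_le_iff_ne_zero.2 (Order.cof_ne_zero_iff.2 inferInstance)

/-- If every cofinality vanishes, every local density is finite, so each point has a finite, hence
compact, neighborhood. -/
theorem one_le_cof_countablyInfiniteSubsets {X : Type u} [MetricSpace X]
    (h : ¬ LocallyCompactSpace X) :
    1 ≤ ⨆ x : X, Order.cof (CountablyInfiniteSubsets (localDensity x)) := by
  by_contra! hlt
  apply h
  rw [Cardinal.lt_one_iff] at hlt
  have : WeaklyLocallyCompactSpace X := ⟨fun x ↦ by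
    obtain ⟨U, hU, D, hUD, hD⟩ := exists_nhds_subset_closure_mk_eq x
    rcases D.finite_or_infinite with hfin | hinf
    · exact ⟨D, hfin.isCompact, mem_of_superset hU (hfin.isClosed.closure_eq ▸ hUD)⟩
    have h0 : Order.cof (CountablyInfiniteSubsets (localDensity x)) = 0 :=
      le_antisymm ((le_ciSup (bddAbove_of_small) x).trans hlt.le) (zero_le)
    rw [Order.cof_eq_zero_iff] at h0
    have : Infinite (localDensity x).out := by
      rw [infinite_iff, mk_out, ← hD]
      have := hinf.to_subtype
      exact aleph0_le_mk D
    refine (h0.false ⟨range (Infinite.natEmbedding _), ?_⟩).elim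
    have hinj := (Infinite.natEmbedding (localDensity x).out).injective
    have := (infinite_range_of_injective hinj).to_subtype
    have := (countable_range (Infinite.natEmbedding (localDensity x).out)).to_subtype
    exact mk_eq_aleph0 _⟩
  infer_instance

theorem cof_compacts_le {X : Type u} [MetricSpace X] [CompleteSpace X] [NoncompactSpace X]
    (h : ¬ LocallyCompactSpace X) :
    Order.cof (Compacts X) ≤ topDensity X * lift.{u} dominatingNumber *
      ⨆ x : X, Order.cof (CountablyInfiniteSubsets (localDensity x)) := by
  have h1 := aleph0_le_topDensity X
  have h2 : 1 ≤ lift.{u} dominatingNumber := by simpa using one_le_dominatingNumber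
  have h3 := one_le_cof_countablyInfiniteSubsets h
  have h4 : topDensity X ≤ topDensity X * lift.{u} dominatingNumber *
      ⨆ x : X, Order.cof (CountablyInfiniteSubsets (localDensity x)) := by
    simpa using mul_le_mul' (mul_le_mul' (le_refl (topDensity X)) h2) h3
  refine cof_compacts_le_of_locally (h1.trans h4) h4 fun x ↦ ?_
  obtain ⟨U, hU, F, hF, hK⟩ := exists_compacts_family x
  refine ⟨U, hU, F, hF.trans (max_le (one_le_aleph0.trans (h1.trans h4)) ?_), hK⟩
  rw [mul_comm, mul_assoc]
  refine le_trans ?_ (mul_le_mul' (one_le_aleph0.trans h1) le_rfl)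
  rw [one_mul]
  exact mul_le_mul' le_rfl (le_ciSup (f := fun x : X ↦
    Order.cof (CountablyInfiniteSubsets (localDensity x))) bddAbove_of_small x)

end UpperBound

/-! ### Lower bounds for the cofinality of the compact sets -/

section LowerBound

theorem exists_separated_net (X : Type u) [PseudoMetricSpace X] {r : ℝ} (hr : 0 < r) :
    ∃ E : Set X, E.Pairwise (fun a b ↦ r ≤ dist a b) ∧ ∀ x, ∃ e ∈ E, dist x e < r := by
  obtain ⟨E, hE⟩ := zorn_subset {E : Set X | E.Pairwise fun a b ↦ r ≤ dist a b}
    fun c hc hchain ↦ ⟨⋃₀ c, (pairwise_sUnion hchain.directedOn).2 hc,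
      fun s hs ↦ subset_sUnion_of_mem hs⟩
  refine ⟨E, hE.prop, fun x ↦ ?_⟩
  by_contra! h
  have hx : x ∈ E := by
    refine hE.le_of_ge (y := insert x E) ?_ (subset_insert x E) (mem_insert x E)
    exact hE.prop.insert fun b hb _ ↦ ⟨h b hb, dist_comm x b ▸ h b hb⟩
  exact hr.not_ge (by simpa using h x hx)

theorem finite_inter_of_pairwise_le_dist {X : Type u} [PseudoMetricSpace X] {r : ℝ} (hr : 0 < r)
    {K E : Set X} (hK : IsCompact K) (hE : E.Pairwise (fun a b ↦ r ≤ dist a b)) :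
    (K ∩ E).Finite := by
  obtain ⟨t, ht, hKt⟩ := Metric.totallyBounded_iff.1 hK.totallyBounded (r / 2) (half_pos hr)
  refine (ht.biUnion (t := fun y ↦ ball y (r / 2) ∩ E) fun y _ ↦ ?_).subset fun x hx ↦ ?_
  · refine Set.Subsingleton.finite fun a ha b hb ↦ ?_
    by_contra hab
    have h1 := hE ha.2 hb.2 hab
    have h2 := dist_triangle_right a b y
    have h3 := mem_ball.1 ha.1
    have h4 := mem_ball.1 hb.1
    linarith
  · obtain ⟨y, hy, hxy⟩ := mem_iUnion₂.1 (hKt hx.1)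
    exact mem_iUnion₂.2 ⟨y, hy, hxy, hx.2⟩

/-- Take the union of maximal `1/(n+1)`-separated sets: a compact set meets each of them in a finite
set. -/
theorem exists_dense_countable_inter_compact (X : Type u) [PseudoMetricSpace X] :
    ∃ D : Set X, Dense D ∧ ∀ K, IsCompact K → (K ∩ D).Countable := by
  have hpos : ∀ n : ℕ, (0 : ℝ) < 1 / (n + 1) := fun n ↦ Nat.one_div_pos_of_nat
  choose E hE hEd using fun n : ℕ ↦ exists_separated_net X (hpos n)
  refine ⟨⋃ n, E n, fun x ↦ Metric.mem_closure_iff.2 fun ε hε ↦ ?_, fun K hK ↦ ?_⟩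
  · obtain ⟨n, hn⟩ := exists_nat_one_div_lt hε
    obtain ⟨e, he, hxe⟩ := hEd n x
    exact ⟨e, mem_iUnion.2 ⟨n, he⟩, hxe.trans hn⟩
  · rw [inter_iUnion]
    exact countable_iUnion fun n ↦ (finite_inter_of_pairwise_le_dist (hpos n) hK (hE n)).countable

theorem tendsto_of_mem_ball_one_div {X : Type u} [PseudoMetricSpace X] {x : X} {s : ℕ → X}
    (hs : ∀ n : ℕ, s n ∈ closedBall x (1 / (n + 1))) : Tendsto s atTop (𝓝 x) :=
  tendsto_iff_dist_tendsto_zero.2 (squeeze_zero (fun _ ↦ dist_nonneg) (fun n ↦ hs n)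
    tendsto_one_div_add_atTop_nhds_zero_nat)

/-- Enumerate `S` and send its `n`-th element by an injection into the part of `D` in the `n`-th
ball at `x`. The images converge to `x`, and a compact `K` containing them captures only countably
many possible elements of `S`. -/
theorem cof_countablyInfiniteSubsets_le {X : Type u} [MetricSpace X] (x : X) :
    Order.cof (CountablyInfiniteSubsets (localDensity x)) ≤ Order.cof (Compacts X) := by
  rcases isEmpty_or_nonempty (CountablyInfiniteSubsets (localDensity x)) with _ | hne
  · simp
  obtain ⟨D, hD, hDK⟩ := exists_dense_countable_inter_compact X
  have hemb : ∀ n : ℕ, Nonempty ((localDensity x).out ↪ ↥(ball x (1 / (n + 1)) ∩ D)) := fun n ↦ by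
    rw [← Cardinal.le_def, mk_out]
    exact localDensity_le (ball_mem_nhds x Nat.one_div_pos_of_nat) inter_subset_left
      (hD.open_subset_closure_inter isOpen_ball)
  let j := fun n ↦ (hemb n).some
  have hnum : ∀ S : CountablyInfiniteSubsets (localDensity x), Nonempty (ℕ ≃ S.1) := fun S ↦ by
    obtain ⟨hS⟩ := denumerable_iff.2 S.2
    exact ⟨(Denumerable.eqv S.1).symm⟩
  let num := fun S ↦ (hnum S).some
  have hconv : ∀ S, Tendsto (fun n ↦ (j n (num S n) : X)) atTop (𝓝 x) := fun S ↦
    tendsto_of_mem_ball_one_div fun n ↦ ball_subset_closedBall (j n (num S n)).2.1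
  have h := lift_cof_le_of_tukey (α := CountablyInfiniteSubsets (localDensity x))
    (β := Compacts X) (fun S ↦ ⟨_, (hconv S).isCompact_insert_range⟩) fun K ↦ ?_
  · simpa using h
  let A : Set (localDensity x).out := ⋃ n, (fun s ↦ (j n s : X)) ⁻¹' (K ∩ D)
  have hA : A.Countable := countable_iUnion fun n ↦
    (hDK K K.isCompact).preimage (Subtype.val_injective.comp (j n).injective)
  have hsub : ∀ S : CountablyInfiniteSubsets (localDensity x),
      (⟨_, (hconv S).isCompact_insert_range⟩ : Compacts X) ≤ K → S.1 ⊆ A := fun S hS s hs ↦ by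
    obtain ⟨n, hn⟩ := (num S).surjective ⟨s, hs⟩
    have hmem : (j n (num S n) : X) ∈ K := hS (Or.inr (mem_range_self n))
    rw [hn] at hmem
    exact mem_iUnion.2 ⟨n, hmem, (j n s).2.2⟩
  by_cases hinf : A.Infinite
  · have := hinf.to_subtype
    have := hA.to_subtype
    exact ⟨⟨A, mk_eq_aleph0 A⟩, hsub⟩
  -- With `A` finite no infinite `S` maps below `K`, so any bound works.
  · refine ⟨hne.some, fun S hS ↦ (hinf ?_).elim⟩
    have : Infinite S.1 := infinite_iff.2 S.2.ge
    exact (infinite_coe_iff.1 this).mono (hsub S hS)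

theorem exists_seq_finite_preimage_compact {X : Type u} [PseudoMetricSpace X] {s : Set X}
    (hs : ¬ IsCompact s) :
    ∃ a : ℕ → X, (∀ n, a n ∈ s) ∧
      ∀ K, IsCompact K → K ⊆ s → (a ⁻¹' K).Finite := by
  rw [isCompact_iff_isSeqCompact] at hs
  simp only [IsSeqCompact, not_forall] at hs
  obtain ⟨a, ha, hna⟩ := hs
  refine ⟨a, fun n ↦ ha n, fun K hK hKs ↦ ?_⟩
  by_contra hinf
  obtain ⟨φ, hφ, hφK⟩ := extraction_of_frequently_atTop (Nat.frequently_atTop_iff_infinite.2 hinf)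
  obtain ⟨y, hy, ψ, hψ, hlim⟩ := hK.isSeqCompact (x := a ∘ φ) hφK
  exact hna ⟨y, hKs hy, φ ∘ ψ, hφ.comp hψ, hlim⟩

/-- At a point without compact closed balls of radius `1/(n+1)`, the `n`-th ball holds a sequence `a
n` with no subsequence converging in it. Send `f` to the convergent sequence `a n (f n)` with its
limit; a compact set contains `a n k` for only finitely many `k`, which bounds `f n`. -/
theorem lift_dominatingNumber_le_cof_compacts {X : Type u} [MetricSpace X]
    (h : ¬ LocallyCompactSpace X) :
    lift.{u} dominatingNumber ≤ Order.cof (Compacts X) := by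
  have hx : ∃ x : X, ∀ n : ℕ, ¬ IsCompact (closedBall x (1 / (n + 1))) := by
    by_contra! hc
    have : WeaklyLocallyCompactSpace X := ⟨fun x ↦ by
      obtain ⟨n, hn⟩ := hc x
      exact ⟨_, hn, closedBall_mem_nhds x Nat.one_div_pos_of_nat⟩⟩
    exact h inferInstance
  obtain ⟨x, hx⟩ := hx
  choose a ha hfin using fun n ↦ exists_seq_finite_preimage_compact (hx n)
  have hconv : ∀ f : ℕ → ℕ, Tendsto (fun n ↦ a n (f n)) atTop (𝓝 x) := fun f ↦
    tendsto_of_mem_ball_one_div fun n ↦ ha n (f n)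
  have h := lift_cof_le_of_tukey (α := ℕ → ℕ)
    (β := Compacts X) (fun f ↦ ⟨_, (hconv f).isCompact_insert_range⟩) fun K ↦ ?_
  · simpa [dominatingNumber] using h
  have hbdd : ∀ n, ∃ m, ∀ k, a n k ∈ K → k ≤ m := fun n ↦ by
    obtain ⟨m, hm⟩ := (hfin n _ (K.isCompact.inter_right isClosed_closedBall)
      inter_subset_right).bddAbove
    exact ⟨m, fun k hk ↦ hm ⟨hk, ha n k⟩⟩
  choose g hg using hbdd
  exact ⟨g, fun f hf n ↦ hg n (f n) (hf (Or.inr (mem_range_self n)))⟩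

theorem aleph0_le_cof_compacts (X : Type u) [TopologicalSpace X] [NoncompactSpace X] :
    ℵ₀ ≤ Order.cof (Compacts X) := by
  obtain ⟨s, hs, hsc⟩ := Order.exists_cof_eq (Compacts X)
  rw [← hsc]
  by_contra! hlt
  have hfin : s.Finite := lt_aleph0_iff_set_finite.1 hlt
  refine noncompact_univ X ?_
  convert hfin.isCompact_biUnion fun K _ ↦ K.isCompact
  refine (eq_univ_of_forall fun x ↦ ?_).symm
  obtain ⟨K, hK, hxK⟩ := hs ⟨{x}, isCompact_singleton⟩
  exact mem_iUnion₂.2 ⟨K, hK, hxK rfl⟩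

theorem topDensity_le_cof_compacts (X : Type u) [MetricSpace X] [NoncompactSpace X] :
    topDensity X ≤ Order.cof (Compacts X) := by
  obtain ⟨s, hs, hsc⟩ := Order.exists_cof_eq (Compacts X)
  have h0 := aleph0_le_cof_compacts X
  rw [← hsc] at h0 ⊢
  obtain ⟨D, hD, hDK⟩ := exists_dense_countable_inter_compact X
  have hsub : D ⊆ ⋃ K ∈ s, ((K : Set X) ∩ D) := fun x hx ↦ by
    obtain ⟨K, hK, hxK⟩ := hs ⟨{x}, isCompact_singleton⟩
    exact mem_iUnion₂.2 ⟨K, hK, hxK rfl, hx⟩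
  refine (topDensity_le hD).trans ((mk_le_mk_of_subset hsub).trans ((mk_biUnion_le _ _).trans
    (mul_le_of_le h0 le_rfl (ciSup_le' fun K ↦ ?_))))
  exact (le_aleph0_iff_set_countable.2 (hDK K.1 K.1.isCompact)).trans h0

end LowerBound

/-! ### Weight of the function space versus cofinality of the compact sets -/

section FunctionSpace

theorem ContinuousMap.exists_isCompact_forall_eqOn_mem {X : Type u} {Y : Type v}
    [TopologicalSpace X] [TopologicalSpace Y] {f : C(X, Y)} {N : Set C(X, Y)} (hN : N ∈ 𝓝 f) :
    ∃ K : Set X, IsCompact K ∧ ∀ g : C(X, Y), EqOn g f K → g ∈ N := by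
  obtain ⟨S, hSf, hS, hSN⟩ := ContinuousMap.mem_nhds_iff.1 hN
  refine ⟨⋃ p ∈ S, p.1, hSf.isCompact_biUnion fun p hp ↦ (hS p.1 p.2 hp).1, fun g hg ↦ hSN ?_⟩
  intro K U hKU x hx
  rw [hg (mem_biUnion hKU hx)]
  exact (hS K U hKU).2.2 hx

/-- Each basic neighborhood `N` of the constant map `c` at an end of the arc contains all maps
agreeing with `c` on some compact `K N`. If `N` forces `L` into `U`, then `L ⊆ K N`: otherwise a
Urysohn function followed by the arc equals `c` on `K N` but leaves `U` at a point of `L`. -/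
theorem lift_cof_compacts_le_topWeight (X : Type u) [MetricSpace X] (G : Type v)
    [TopologicalSpace G] (hG : ContainsArc G) :
    lift.{v} (Order.cof (Compacts X)) ≤ topWeight C(X, G) := by
  obtain ⟨A, ⟨e⟩⟩ := hG
  let γ : C(unitInterval, G) := ⟨fun t ↦ e.symm t, by fun_prop⟩
  have hγ : IsInducing γ := IsInducing.subtypeVal.comp e.symm.isInducing
  obtain ⟨U, hU, hγU⟩ := hγ.isOpen_iff.1 (isOpen_Iio (a := (1 : unitInterval)))
  have h0 : γ 0 ∈ U := by
    change (0 : unitInterval) ∈ γ ⁻¹' U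
    rw [hγU]
    exact mem_Iio.2 zero_lt_one
  have h1 : γ 1 ∉ U := by
    change (1 : unitInterval) ∉ γ ⁻¹' U
    rw [hγU]
    exact self_notMem_Iio
  obtain ⟨B, hB, hBw⟩ := exists_isTopologicalBasis_mk_eq C(X, G)
  let c : C(X, G) := .const X (γ 0)
  have hK : ∀ N : {N : Set C(X, G) // N ∈ B ∧ c ∈ N}, ∃ K : Compacts X,
      ∀ g : C(X, G), EqOn g c K → g ∈ N.1 := fun N ↦ by
    obtain ⟨K, hK, h⟩ := ContinuousMap.exists_isCompact_forall_eqOn_mem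
      ((hB.isOpen N.2.1).mem_nhds N.2.2)
    exact ⟨⟨K, hK⟩, h⟩
  choose K hK using hK
  have hcof : IsCofinal (range K) := fun L ↦ by
    have hc : c ∈ {f : C(X, G) | MapsTo f L U} := fun _ _ ↦ h0
    obtain ⟨N, hNB, hcN, hN⟩ := hB.exists_subset_of_mem_open hc
      (ContinuousMap.isOpen_setOfPred_mapsTo L.isCompact hU)
    refine ⟨_, mem_range_self ⟨N, hNB, hcN⟩, fun y hy ↦ ?_⟩
    by_contra hyK
    obtain ⟨φ, hφ0, hφ1, hφ⟩ := exists_continuous_zero_one_of_isClosed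
      (K ⟨N, hNB, hcN⟩).isCompact.isClosed isClosed_singleton (disjoint_singleton_right.2 hyK)
    let ψ : C(X, unitInterval) := ⟨fun x ↦ ⟨φ x, hφ x⟩, by fun_prop⟩
    have hmem := hN (hK ⟨N, hNB, hcN⟩ (γ.comp ψ) fun x hx ↦
      congrArg γ (Subtype.ext (hφ0 hx) : ψ x = 0)) hy
    exact h1 ((Subtype.ext (hφ1 rfl) : ψ y = 1) ▸ hmem)
  calc lift.{v} (Order.cof (Compacts X)) ≤ lift.{v} #(range K) := lift_le.2 (Order.cof_le hcof)
    _ ≤ #{N : Set C(X, G) // N ∈ B ∧ c ∈ N} := by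
      have := mk_range_le_lift (f := K)
      rwa [lift_umax.{u, v}, lift_id'.{u, max u v}] at this
    _ ≤ #B := mk_le_of_injective
      (f := fun N ↦ ⟨N.1, N.2.1⟩) fun _ _ h ↦ Subtype.ext (Subtype.mk.inj h)
    _ = _ := hBw

theorem TopologicalSpace.IsTopologicalBasis.exists_list_between {Y : Type v} [TopologicalSpace Y]
    {B : Set (Set Y)} (hB : IsTopologicalBasis B) {K U : Set Y} (hK : IsCompact K) (hU : IsOpen U)
    (h : K ⊆ U) : ∃ l : List B, K ⊆ ⋃ b ∈ l, b.1 ∧ ⋃ b ∈ l, b.1 ⊆ U := by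
  obtain ⟨t, ht⟩ := hK.elim_finite_subcover (fun b : {b : B // b.1 ⊆ U} ↦ b.1.1)
    (fun b ↦ hB.isOpen b.1.2) fun y hy ↦ by
      obtain ⟨b, hbB, hyb, hbU⟩ := hB.exists_subset_of_mem_open (h hy) hU
      exact mem_iUnion.2 ⟨⟨⟨b, hbB⟩, hbU⟩, hyb⟩
  refine ⟨t.toList.map (↑), ht.trans ?_, ?_⟩
  · exact iUnion₂_subset fun b hb ↦ subset_iUnion₂_of_subset b.1
      (List.mem_map_of_mem (Finset.mem_toList.2 hb)) subset_rfl
  · refine iUnion₂_subset fun b hb ↦ ?_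
    obtain ⟨b', -, rfl⟩ := List.mem_map.1 hb
    exact b'.2

/-- Intersect `K` with finite unions of closed balls of radius `1/(n+1)` around a countable set
whose closure contains `K`. -/
theorem exists_seq_compacts_between {X : Type u} [MetricSpace X] (K : Compacts X) :
    ∃ L : ℕ → Compacts X, ∀ M V : Set X, IsCompact M → M ⊆ K → IsOpen V → M ⊆ V →
      ∃ n, M ⊆ L n ∧ (L n : Set X) ⊆ V := by
  classical
  obtain ⟨Q, hQ, hKQ⟩ := K.isCompact.isSeparable
  have := hQ.to_subtype
  let P : Finset (Q × ℕ) → Compacts X := fun t ↦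
    ⟨K ∩ ⋃ p ∈ t, closedBall (p.1 : X) (1 / (p.2 + 1)),
      K.isCompact.inter_right (t.finite_toSet.isClosed_biUnion fun _ _ ↦ isClosed_closedBall)⟩
  obtain ⟨num, hnum⟩ := exists_surjective_nat (Finset (Q × ℕ))
  refine ⟨P ∘ num, fun M V hM hMK hV hMV ↦ ?_⟩
  obtain ⟨t, ht⟩ := hM.elim_finite_subcover
    (fun p : {p : Q × ℕ // closedBall (p.1 : X) (1 / (p.2 + 1)) ⊆ V} ↦
      ball (p.1.1 : X) (1 / (p.1.2 + 1))) (fun _ ↦ isOpen_ball) fun y hy ↦ by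
      obtain ⟨ε, hε, hεV⟩ := Metric.isOpen_iff.1 hV y (hMV hy)
      obtain ⟨n, hn⟩ := exists_nat_one_div_lt (half_pos hε)
      obtain ⟨q, hq, hyq⟩ := Metric.mem_closure_iff.1 (hKQ (hMK hy)) (1 / (n + 1))
        Nat.one_div_pos_of_nat
      refine mem_iUnion.2 ⟨⟨(⟨q, hq⟩, n), fun z hz ↦ hεV ?_⟩, hyq⟩
      rw [mem_closedBall] at hz
      rw [mem_ball]
      have := dist_triangle_right z y q
      dsimp only at hz
      linarith
  obtain ⟨n, hn⟩ := hnum (t.image (↑))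
  refine ⟨n, fun y hy ↦ ?_, ?_⟩
  · simp only [Function.comp_apply, hn]
    obtain ⟨p, hp, hyp⟩ := mem_iUnion₂.1 (ht hy)
    exact ⟨hMK hy, mem_iUnion₂.2 ⟨p.1, Finset.mem_image_of_mem _ hp, ball_subset_closedBall hyp⟩⟩
  · simp only [Function.comp_apply, hn]
    refine inter_subset_right.trans (iUnion₂_subset fun p hp ↦ ?_)
    obtain ⟨p', -, rfl⟩ := Finset.mem_image.1 hp
    exact p'.2

theorem topWeight_le_of_eq_generateFrom {X : Type u} [t : TopologicalSpace X] {S : Set (Set X)}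
    (hS : t = generateFrom S) : topWeight X ≤ max ℵ₀ #S := by
  refine (topWeight_le (isTopologicalBasis_of_subbasis hS)).trans
    (le_trans ?_ ((mk_range_le (f := fun l : List S ↦ ⋂ s ∈ l, s.1)).trans (mk_list_le_max S)))
  refine mk_le_mk_of_subset ?_
  rintro _ ⟨f, ⟨hf, hfS⟩, rfl⟩
  lift f to Finset (Set X) using hf
  refine ⟨f.attach.toList.map fun s ↦ ⟨s.1, hfS s.2⟩, ?_⟩
  ext x
  simp only [mem_iInter, mem_sInter, List.mem_map, Finset.mem_toList, Finset.mem_coe]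
  constructor
  · exact fun h s hs ↦ h ⟨s, hfS hs⟩ ⟨⟨s, hs⟩, Finset.mem_attach _ _, rfl⟩
  · rintro h _ ⟨s, -, rfl⟩
    exact h s.1 s.2

theorem one_le_topWeight (X : Type u) [TopologicalSpace X] [Nonempty X] : 1 ≤ topWeight X := by
  obtain ⟨B, hB, hBw⟩ := exists_isTopologicalBasis_mk_eq X
  rw [← hBw, Cardinal.one_le_iff_ne_zero, mk_ne_zero_iff, nonempty_coe_sort]
  obtain ⟨b, hb, -⟩ := hB.exists_subset_of_mem_open (mem_univ (Classical.arbitrary X)) isOpen_univ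
  exact ⟨b, hb⟩

theorem topWeight_continuousMap_le (X : Type u) [MetricSpace X] [NoncompactSpace X] (G : Type v)
    [TopologicalSpace G] [Nonempty G] :
    topWeight C(X, G) ≤ lift.{u} (topWeight G) * lift.{v} (Order.cof (Compacts X)) := by
  obtain ⟨B, hB, hBw⟩ := exists_isTopologicalBasis_mk_eq G
  obtain ⟨F, hF, hFc⟩ := Order.exists_cof_eq (Compacts X)
  choose L hL using fun K : Compacts X ↦ exists_seq_compacts_between K
  -- For `f` mapping `M` into `U`, first a finite union of basic sets fits between `f '' M` and `U`,
  -- then some `L K n` between `M` and the preimage of that union.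
  let W : F × ℕ × List B → Set C(X, G) := fun p ↦
    {f | MapsTo f (L p.1 p.2.1) (⋃ b ∈ p.2.2, b.1)}
  have hgen : (ContinuousMap.compactOpen : TopologicalSpace C(X, G)) = generateFrom (range W) := by
    refine le_antisymm (le_generateFrom ?_) ?_
    · rintro _ ⟨p, rfl⟩
      exact ContinuousMap.isOpen_setOfPred_mapsTo (L p.1 p.2.1).isCompact
        (isOpen_biUnion fun b _ ↦ hB.isOpen b.2)
    · rw [ContinuousMap.compactOpen_eq]
      refine le_generateFrom ?_
      rintro _ ⟨M, hM, U, hU, rfl⟩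
      let := generateFrom (range W)
      refine isOpen_iff_forall_mem_open.2 fun f hf ↦ ?_
      obtain ⟨l, hl, hlU⟩ := hB.exists_list_between (hM.image f.continuous) hU
        hf.image_subset
      obtain ⟨K, hK, hMK⟩ := hF ⟨M, hM⟩
      obtain ⟨n, hn, hnV⟩ := hL K M (f ⁻¹' ⋃ b ∈ l, b.1) hM hMK
        ((isOpen_biUnion fun b _ ↦ hB.isOpen b.2).preimage f.continuous) (image_subset_iff.1 hl)
      exact ⟨W (⟨K, hK⟩, n, l), fun g hg x hx ↦ hlU (hg (hn hx)),
        isOpen_generateFrom_of_mem (mem_range_self _), fun x hx ↦ hnV hx⟩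
  have hc1 : lift.{v} (Order.cof (Compacts X)) ≤
      lift.{u} (topWeight G) * lift.{v} (Order.cof (Compacts X)) := by
    have : 1 ≤ lift.{u} (topWeight G) := by simpa using one_le_topWeight G
    simpa using mul_le_mul' this (le_refl (lift.{v} (Order.cof (Compacts X))))
  have h0 : ℵ₀ ≤ lift.{v} (Order.cof (Compacts X)) := by simpa using aleph0_le_cof_compacts X
  have hc2 : lift.{u} (topWeight G) ≤
      lift.{u} (topWeight G) * lift.{v} (Order.cof (Compacts X)) := by
    simpa using mul_le_mul' (le_refl (lift.{u} (topWeight G))) (one_le_aleph0.trans h0)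
  have hc := h0.trans hc1
  have hlist : lift.{u} #(List B) ≤ max ℵ₀ (lift.{u} (topWeight G)) := by
    have := lift_le.{u}.2 (mk_list_le_max B)
    rwa [lift_max, lift_aleph0, hBw] at this
  have hW : #(range W) ≤ lift.{v} #F * (ℵ₀ * lift.{u} #(List B)) := by
    have := mk_range_le_lift (f := W)
    simpa using this
  refine (topWeight_le_of_eq_generateFrom hgen).trans (max_le hc (hW.trans ?_))
  rw [hFc]
  exact mul_le_of_le hc hc1 (mul_le_of_le hc hc (hlist.trans (max_le hc hc2)))

end FunctionSpace

theorem mainTheorem6 (X : Type u) [MetricSpace X] [CompleteSpace X] [NoncompactSpace X]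
    (hX : ¬ DiscreteTopology X)
    (G : Type v) [Group G] [TopologicalSpace G] [IsTopologicalGroup G] (hG : ContainsArc G) :
    (LocallyCompactSpace X →
      lift.{v} (topDensity X) ≤ topWeight C(X, G) ∧
      topWeight C(X, G) ≤ lift.{u} (topWeight G) * lift.{v} (topDensity X)) ∧
    (¬ LocallyCompactSpace X →
      lift.{v} (topDensity X * lift.{u} dominatingNumber *
          ⨆ x : X, Order.cof (CountablyInfiniteSubsets (localDensity x))) ≤
        topWeight C(X, G) ∧
      topWeight C(X, G) ≤
        lift.{u} (topWeight G) *
          lift.{v} (topDensity X * lift.{u} dominatingNumber *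
            ⨆ x : X, Order.cof (CountablyInfiniteSubsets (localDensity x)))) := by
  have hlow := lift_cof_compacts_le_topWeight X G hG
  have hup := topWeight_continuousMap_le X G
  have h0 := aleph0_le_cof_compacts X
  have hd := topDensity_le_cof_compacts X
  refine ⟨fun _ ↦ ⟨(lift_le.2 hd).trans hlow,
    hup.trans (mul_le_mul' le_rfl (lift_le.2 (cof_compacts_le_topDensity X)))⟩,
    fun h ↦ ⟨(lift_le.2 ?_).trans hlow,
      hup.trans (mul_le_mul' le_rfl (lift_le.2 (cof_compacts_le h)))⟩⟩
  exact mul_le_of_le h0 (mul_le_of_le h0 hd (lift_dominatingNumber_le_cof_compacts h))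
    (ciSup_le' cof_countablyInfiniteSubsets_le)
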